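/- All graphs are finite, and simple unless called multigraphs. For a bipartite multigraph $H$ (parallel edges allowed, no loops), let $L(H)$ be its line graph: its vertices are the edges of $H$, and two distinct edges are adjacent in $L(H)$ if and only if they have at least one common end-vertex. A graph $G$ is called a skew graph if it is isomorphic to the complement $\overline{L(H)}$ of the line graph of some bipartite multigraph $H$. For a graph $G$ and $S\subseteq V(G)$, let $c(G\setminus S)$ denote the number of connected components of the graph obtained from $G$ by deleting the vertices in $S$; $G$ is called pathwise tough if $c(G\setminus S)\le |S|+1$ for every $S\subseteq V(G)$. A Hamiltonian path of $G$ is a path that contains every vertex of $G$. Let $G$ be a skew graph with at least one vertex. Then $G$ contains a Hamiltonian path if and only if $G$ is pathwise tough. -/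

import Mathlib

universe u v w

/-- A multigraph is bipartite if its vertices can be split into two sides, `X` and its complement,
such that every edge has one end in each side. In particular it has no loops. -/
def Graph.IsBipartite {α : Type v} {β : Type w} (H : Graph α β) : Prop :=
  ∃ X : Set α, ∀ ⦃e : β⦄ ⦃x y : α⦄, H.IsLink e x y → (x ∈ X ↔ y ∉ X)

/-- The line graph of a multigraph: its vertices are the edges of `H`, and two distinct edges
are adjacent if and only if they have at least one common end-vertex. -/
def Graph.lineGraph {α : Type v} {β : Type w} (H : Graph α β) : SimpleGraph H.edgeSet where
  Adj e f := e ≠ f ∧ ∃ x : α, H.Inc e x ∧ H.Inc f x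
  symm := ⟨fun _ _ ⟨hne, x, he, hf⟩ => ⟨hne.symm, x, hf, he⟩⟩
  loopless := ⟨fun _ h => h.1 rfl⟩

/-- A skew graph is a graph of the form (up to isomorphism) complement of `L(H)`, where `H` is a
bipartite multigraph. -/
def SimpleGraph.IsSkew {V : Type u} (G : SimpleGraph V) : Prop :=
  ∃ (α : Type v) (β : Type w) (H : Graph α β),
    H.IsBipartite ∧ Nonempty (G ≃g H.lineGraphᶜ)

/-- A finite graph is pathwise tough if `c(G ∖ S) ≤ |S| + 1` for every set `S` of vertices, where
`c` is the number of connected components. -/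
def SimpleGraph.IsPathwiseTough {V : Type u} [Fintype V] (G : SimpleGraph V) : Prop :=
  ∀ S : Finset V,
    Nat.card (G.induce ((S : Set V)ᶜ)).ConnectedComponent ≤ S.card + 1

/-- The graph contains a Hamiltonian path. -/
def SimpleGraph.HasHamiltonianPath {V : Type u} [DecidableEq V] (G : SimpleGraph V) : Prop :=
  ∃ (a b : V) (p : G.Walk a b), p.IsHamiltonian

/-! If `H` has sides `X` and `Y`, a vertex of `G` is an edge of `H`, that is, a point in a grid
whose row is its end in `X` and whose column is its end in `Y`. Two points are adjacent iff both
coordinates differ, so a Hamiltonian path is an ordering of the points in which consecutive ones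
share no line.

Only a few sets `S` matter for toughness. Taking as the remaining vertices a single line, the union
of the two lines through a point, or everything gives the numerical conditions `IsBalanced`
(`SimpleGraph.IsPathwiseTough.isBalanced`). These suffice, by induction on the number of points.
`IsBalanced.exists_erase` deletes a point `e` that meets every inequality which is tight, so that
what is left is again balanced. `IsLinePair.insertable` puts `e` back into a chain of the rest: if
no rerouting of the chain makes room for `e`, the chain alternates so rigidly that one of the bounds
at `e` is violated. The converse is the usual count of the components that a path visits.

Below, a point is called free if it is adjacent to `e`, and a condition tight if it holds with
equality. -/

section Insertion

variable {V : Type*}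

/-- `P` and `Q` are the sets of points on the two lines through the point `e`. -/
structure IsLinePair (adj : V → V → Prop) (P Q : V → Prop) (e : V) : Prop where
  symm : ∀ {x y}, adj x y → adj y x
  left : ∀ {x y}, P x → P y → ¬ adj x y
  right : ∀ {x y}, Q x → Q y → ¬ adj x y
  cross : ∀ {x y}, P x → ¬ Q x → Q y → ¬ P y → adj x y
  center : ∀ {x}, adj x e ↔ ¬ P x ∧ ¬ Q x

theorem IsLinePair.swap {adj : V → V → Prop} {P Q : V → Prop} {e : V}
    (h : IsLinePair adj P Q e) : IsLinePair adj Q P e where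
  symm := h.symm
  left := h.right
  right := h.left
  cross h1 h2 h3 h4 := h.symm (h.cross h3 h4 h1 h2)
  center := h.center.trans and_comm

/-- The elements of `l` together with `e` can be arranged in a chain. -/
def Insertable (adj : V → V → Prop) (e : V) (l : List V) : Prop :=
  ∃ l' : List V, l'.Perm (e :: l) ∧ l'.IsChain adj

/-! ### Rerouting a chain to make room for a point -/

theorem insertable_of_slot {adj : V → V → Prop} {e : V} {p q : List V}
    (hc : (p ++ q).IsChain adj) (hp : ∀ x ∈ p.getLast?, adj x e) (hq : ∀ y ∈ q.head?, adj e y) :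
    Insertable adj e (p ++ q) := by
  refine ⟨p ++ e :: q, List.perm_middle, ?_⟩
  rw [List.isChain_append] at hc
  rw [List.isChain_append, List.isChain_cons]
  exact ⟨hc.1, ⟨hq, hc.2.1⟩, by simpa using hp⟩

theorem isChain_reverse_of_symm {adj : V → V → Prop} (hs : ∀ {x y}, adj x y → adj y x)
    {l : List V} (hc : l.IsChain adj) : l.reverse.IsChain adj := by
  rw [List.isChain_reverse]
  exact hc.imp fun _ _ h => hs h

/-- Reversing the block `a` brings its free last element next to `e`; the junction this creates
further on is `y`, `y'`. -/
theorem insertable_of_starts {adj : V → V → Prop} (hs : ∀ {x y}, adj x y → adj y x)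
    {e y y' : V} {p a s : List V}
    (hc : (p ++ (a ++ s)).IsChain adj) (hp : ∀ x ∈ p.getLast?, adj x e)
    (ha : ∀ x ∈ a.getLast?, adj x e) (hy : y ∈ a.head?) (hy' : y' ∈ s.head?) (hyy : adj y y') :
    Insertable adj e (p ++ (a ++ s)) := by
  refine ⟨p ++ e :: (a.reverse ++ s), ?_, ?_⟩
  · exact List.perm_middle.trans (((List.reverse_perm a).append_right s).append_left p |>.cons e)
  · simp only [List.isChain_append, List.isChain_cons] at hc ⊢
    refine ⟨hc.1, ⟨?_, isChain_reverse_of_symm hs hc.2.1.1, hc.2.1.2.1, ?_⟩, by simpa using hp⟩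
    · intro x hx
      have : a ≠ [] := by rintro rfl; simp at hy
      rw [List.head?_append_of_ne_nil _ (by simpa using this), List.head?_reverse] at hx
      exact hs (ha x hx)
    · rw [List.getLast?_reverse]
      intro x hx z hz
      obtain rfl := Option.mem_unique hx hy
      obtain rfl := Option.mem_unique hz hy'
      exact hyy

theorem insertable_of_ends {adj : V → V → Prop} (hs : ∀ {x y}, adj x y → adj y x)
    {e x x' : V} {p a s : List V}
    (hc : (p ++ (a ++ s)).IsChain adj) (ha : ∀ y ∈ a.head?, adj e y)
    (hsh : ∀ y ∈ s.head?, adj e y) (hx : x ∈ p.getLast?) (hx' : x' ∈ a.getLast?)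
    (hxx : adj x x') : Insertable adj e (p ++ (a ++ s)) := by
  have hc' := isChain_reverse_of_symm hs hc
  simp only [List.reverse_append, List.append_assoc] at hc'
  obtain ⟨l', hl, hch⟩ := insertable_of_starts hs hc' (e := e) (y := x') (y' := x)
    (by simpa using fun y hy => hs (hsh y hy)) (by simpa using fun y hy => hs (ha y hy))
    (by simpa using hx') (by simpa using hx) (hs hxx)
  refine ⟨l', hl.trans (List.Perm.cons e ?_), hch⟩
  simpa using List.reverse_perm (p ++ (a ++ s))

/-- The two cuts differ because `x` is not adjacent to itself, so the stretch between them is the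
block to be reversed. Whichever cut comes first, `insertable_of_ends` applies. -/
theorem insertable_of_two_ends {adj : V → V → Prop} (hs : ∀ {x y}, adj x y → adj y x)
    {e x x' : V} {p q p' q' : List V} (hc : (p ++ q).IsChain adj) (heq : p ++ q = p' ++ q')
    (hq : ∀ y ∈ q.head?, adj y e) (hq' : ∀ y ∈ q'.head?, adj y e) (hx : x ∈ p.getLast?)
    (hx' : x' ∈ p'.getLast?) (hxx : adj x x') (hirr : ¬ adj x x) : Insertable adj e (p ++ q) := by
  have hne : x ≠ x' := by rintro rfl; exact hirr hxx
  obtain ⟨a, rfl, rfl⟩ | ⟨a, rfl, rfl⟩ := List.append_eq_append_iff.1 heq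
  · have ha : a ≠ [] := by
      rintro rfl
      exact hne (Option.mem_unique hx (by simpa using hx'))
    rw [List.getLast?_append_of_ne_nil _ ha] at hx'
    rw [List.head?_append_of_ne_nil _ ha] at hq
    exact insertable_of_ends hs hc (fun y hy => hs (hq y hy)) (fun y hy => hs (hq' y hy))
      hx hx' hxx
  · have ha : a ≠ [] := by
      rintro rfl
      exact hne (Option.mem_unique (by simpa using hx) hx')
    rw [List.getLast?_append_of_ne_nil _ ha] at hx
    rw [List.head?_append_of_ne_nil _ ha] at hq'
    rw [List.append_assoc] at hc ⊢
    exact insertable_of_ends hs hc (fun y hy => hs (hq' y hy)) (fun y hy => hs (hq y hy))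
      hx' hx (hs hxx)

theorem insertable_of_two_starts {adj : V → V → Prop} (hs : ∀ {x y}, adj x y → adj y x)
    {e y y' : V} {p q p' q' : List V} (hc : (p ++ q).IsChain adj) (heq : p ++ q = p' ++ q')
    (hp : ∀ x ∈ p.getLast?, adj x e) (hp' : ∀ x ∈ p'.getLast?, adj x e) (hy : y ∈ q.head?)
    (hy' : y' ∈ q'.head?) (hyy : adj y y') (hirr : ¬ adj y y) : Insertable adj e (p ++ q) := by
  have hc' := isChain_reverse_of_symm hs hc
  rw [List.reverse_append] at hc'
  obtain ⟨l', hl, hch⟩ := insertable_of_two_ends hs hc' (e := e) (x := y) (x' := y')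
    (p' := q'.reverse) (q' := p'.reverse) (by simpa using congrArg List.reverse heq)
    (by simpa using hp) (by simpa using hp') (by simpa using hy) (by simpa using hy') hyy hirr
  refine ⟨l', hl.trans (List.Perm.cons e ?_), hch⟩
  simpa using List.reverse_perm (p ++ q)

/-! ### Counting along alternating lists -/

theorem two_mul_countP_of_alternating (P : V → Prop) [DecidablePred P] (x : V) (l : List V)
    (hc : (x :: l).IsChain fun a b => ¬ (P a ↔ P b)) :
    2 * (x :: l).countP (fun a => decide (P a)) + 1 = (x :: l).length + (if P x then 1 else 0) +
      (if P ((x :: l).getLast (by simp)) then 1 else 0) := by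
  induction l generalizing x with
  | nil => by_cases h : P x <;> simp [h]
  | cons y l ih =>
    rw [List.isChain_cons_cons] at hc
    have := ih y hc.2
    rw [List.countP_cons, List.getLast_cons (by simp)]
    by_cases h : P x <;> by_cases h' : P y <;> simp_all <;> omega

theorem two_mul_countP_eq_length (P : V → Prop) [DecidablePred P] (l : List V)
    (hc : l.IsChain fun a b => ¬ (P a ↔ P b)) (hl : ∀ x ∈ l.head?, ∀ y ∈ l.getLast?, ¬ (P x ↔ P y)) :
    2 * l.countP (fun a => decide (P a)) = l.length := by
  cases l with
  | nil => simp
  | cons x l =>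
    have := two_mul_countP_of_alternating P x l hc
    have h := hl x (by simp) ((x :: l).getLast (by simp)) (List.getLast_mem_getLast? _)
    by_cases h1 : P x <;> by_cases h2 : P ((x :: l).getLast (by simp)) <;> simp_all

theorem length_lt_two_mul_countP (P : V → Prop) [DecidablePred P] (l : List V) (hne : l ≠ [])
    (hc : l.IsChain fun a b => ¬ (P a ↔ P b)) (hh : ∀ x ∈ l.head?, P x)
    (hl : ∀ x ∈ l.getLast?, P x) :
    l.length < 2 * l.countP (fun a => decide (P a)) := by
  cases l with
  | nil => simp at hne
  | cons x l =>
    have := two_mul_countP_of_alternating P x l hc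
    rw [if_pos (hh x (by simp)), if_pos (hl _ (List.getLast_mem_getLast? _))] at this
    omega

/-- Between two consecutive free points `e` could be inserted directly. -/
theorem IsLinePair.isChain_slot {adj : V → V → Prop} {e : V} {l : List V}
    (hs : ∀ {x y}, adj x y → adj y x) (hc : l.IsChain adj) (hno : ¬ Insertable adj e l) :
    l.IsChain fun x y => adj x y ∧ ¬ (adj x e ∧ adj y e) := by
  rw [List.isChain_iff_forall_rel_of_append_cons_cons]
  rintro x y p q rfl
  refine ⟨(List.isChain_append_cons_cons.1 hc).2.1, fun h => hno ?_⟩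
  have heq : p ++ x :: y :: q = (p ++ [x]) ++ (y :: q) := by simp
  rw [heq] at hc ⊢
  exact insertable_of_slot hc (by simpa using h.1) (by simpa using hs h.2)

/-- If every point of the list lies on both or on none of the two lines, then the first line
contains more than half of the points. -/
theorem IsLinePair.length_lt_of_forall_iff {adj : V → V → Prop} {P Q : V → Prop} {e : V}
    [DecidablePred P] (h : IsLinePair adj P Q e) {l : List V} (hc : l.IsChain adj)
    (hno : ¬ Insertable adj e l) (hPQ : ∀ x ∈ l, P x ↔ Q x) :
    l.length < 2 * l.countP (fun a => decide (P a)) := by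
  have key : ∀ x ∈ l, ¬ P x → adj x e := fun x hx hP => h.center.2 ⟨hP, fun hQ => hP ((hPQ x hx).2 hQ)⟩
  refine length_lt_two_mul_countP P l ?_ ?_ ?_ ?_
  · rintro rfl
    exact hno ⟨[e], by simp, by simp⟩
  · refine (isChain_slot h.symm hc hno).imp_of_mem_imp ?_
    rintro x y hx hy ⟨hxy, hxy'⟩ hiff
    by_cases hx' : P x
    · exact h.left hx' (hiff.1 hx') hxy
    · exact hxy' ⟨key x hx hx', key y hy fun h => hx' (hiff.2 h)⟩
  · intro x hx
    by_contra hP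
    exact hno (insertable_of_slot (p := []) hc (by simp) fun y hy => by
      obtain rfl := Option.mem_unique hx hy
      exact h.symm (key x (List.mem_of_mem_head? hx) hP))
  · intro x hx
    by_contra hP
    rw [← List.append_nil l] at hc hno
    exact hno (insertable_of_slot hc (fun y hy => by
      obtain rfl := Option.mem_unique hx hy
      exact key x (List.mem_of_mem_getLast? hx) hP) (by simp))

theorem List.exists_split_of_exists_mem {p : V → Prop} {l : List V} (h : ∃ x ∈ l, p x) :
    ∃ a x b, l = a ++ x :: b ∧ p x ∧ ∀ y ∈ a, ¬ p y := by
  induction l with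
  | nil => simp at h
  | cons z l ih =>
    by_cases hz : p z
    · exact ⟨[], z, l, rfl, hz, by simp⟩
    · obtain ⟨a, x, b, rfl, hx, ha⟩ := ih (by simpa [hz] using h)
      exact ⟨z :: a, x, b, rfl, hx, by simpa [hz] using ha⟩

theorem List.exists_maximal_prefix (p : V → Prop) (l : List V) :
    ∃ a b, l = a ++ b ∧ (∀ y ∈ a, p y) ∧ ∀ y ∈ b.head?, ¬ p y := by
  induction l with
  | nil => exact ⟨[], [], rfl, by simp, by simp⟩
  | cons z l ih =>
    by_cases hz : p z
    · obtain ⟨a, b, rfl, ha, hb⟩ := ih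
      exact ⟨z :: a, b, rfl, by simpa [hz] using ha, hb⟩
    · exact ⟨[], z :: l, rfl, by simp, by simpa using hz⟩

/-- A maximal block of points lying on exactly one of the two lines, which starts on the first
line and ends on the second one, can be moved to another place where the two lines alternate. -/
theorem IsLinePair.insertable_of_move {adj : V → V → Prop} {P Q : V → Prop} {e : V}
    (h : IsLinePair adj P Q e) {p g q s : List V} {x z a b : V}
    (hc : (p ++ (g ++ (q ++ a :: b :: s))).IsChain adj) (hx : x ∈ g.head?) (hz : z ∈ g.getLast?)
    (hxP : P x) (hxQ : ¬ Q x) (hzP : ¬ P z) (hzQ : Q z) (haP : P a) (haQ : ¬ Q a)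
    (hbP : ¬ P b) (hbQ : Q b) (hp : ∀ y ∈ p.getLast?, adj y e)
    (hq : ∀ y ∈ q.head?, adj y e) (hqne : q ≠ []) :
    Insertable adj e (p ++ (g ++ (q ++ a :: b :: s))) := by
  refine ⟨p ++ e :: (q ++ a :: (g.reverse ++ b :: s)), ?_, ?_⟩
  · refine List.perm_middle.trans (List.Perm.cons e (List.Perm.append_left p ?_))
    calc q ++ a :: (g.reverse ++ b :: s) = (q ++ [a]) ++ (g.reverse ++ b :: s) := by simp
      _ |>.Perm (g.reverse ++ b :: s ++ (q ++ [a])) := List.perm_append_comm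
      _ |>.Perm (g ++ b :: s ++ (q ++ [a])) := by
        gcongr
        exact List.reverse_perm g
      _ = g ++ (b :: s ++ (q ++ [a])) := by simp
      _ |>.Perm (g ++ ((q ++ [a]) ++ b :: s)) := List.perm_append_comm.append_left g
      _ = g ++ (q ++ a :: b :: s) := by simp
  · simp only [List.isChain_append, List.isChain_cons] at hc ⊢
    obtain ⟨hcp, ⟨hcg, ⟨hcq, ⟨-, hbs⟩, hqa⟩, -⟩, -⟩ := hc
    refine ⟨hcp, ⟨?_, hcq, ⟨?_, isChain_reverse_of_symm h.symm hcg, hbs, ?_⟩, ?_⟩, by simpa using hp⟩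
    · intro y hy
      rw [List.head?_append_of_ne_nil _ hqne] at hy
      exact h.symm (hq y hy)
    · intro y hy
      have : g ≠ [] := by rintro rfl; simp at hx
      rw [List.head?_append_of_ne_nil _ (by simpa using this), List.head?_reverse] at hy
      obtain rfl := Option.mem_unique hy hz
      exact h.cross haP haQ hzQ hzP
    · intro y hy w hw
      rw [List.getLast?_reverse] at hy
      obtain rfl := Option.mem_unique hy hx
      obtain rfl : b = w := by simpa using hw
      exact h.cross hxP hxQ hbQ hbP
    · simpa using hqa

theorem countP_congr_of_iff {P Q : V → Prop} [DecidablePred P] [DecidablePred Q] {l : List V}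
    (h : ∀ x ∈ l, P x ↔ Q x) :
    l.countP (fun a => decide (P a)) = l.countP (fun a => decide (Q a)) :=
  List.countP_congr (by simpa using h)

theorem countP_add_countP_of_not_iff {P Q : V → Prop} [DecidablePred P] [DecidablePred Q]
    {l : List V} (h : ∀ x ∈ l, ¬ (P x ↔ Q x)) :
    l.countP (fun a => decide (P a)) + l.countP (fun a => decide (Q a)) = l.length := by
  induction l with
  | nil => simp
  | cons x l ih =>
    have h1 := h x (by simp)
    have h2 := ih fun y hy => h y (by simp [hy])
    rw [List.countP_cons, List.countP_cons, List.length_cons]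
    by_cases hP : P x <;> by_cases hQ : Q x <;> simp_all <;> omega

/-- Here `x` is the first point on exactly one line. Let `g` be the maximal block of such points
starting at `x`, with last point `z`, and let `r` be the rest. The last point of `p` and the first
of `r`, if any, are free, so both borders of `g` can serve as cuts in a reversal. If `e` does not
fit, the resulting obstructions force an alternation that contradicts `hP` when `z` lies on the
first line, and `hD` otherwise. -/
theorem IsLinePair.insertable_aux {adj : V → V → Prop} {P Q : V → Prop} {e : V}
    [DecidablePred P] [DecidablePred Q] (h : IsLinePair adj P Q e) {p s : List V} {x : V}
    (hc : (p ++ x :: s).IsChain adj) (hpPQ : ∀ y ∈ p, P y ↔ Q y) (hxP : P x) (hxQ : ¬ Q x)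
    (hP : 2 * (p ++ x :: s).countP (fun a => decide (P a)) ≤ (p ++ x :: s).length)
    (hD : (∃ y ∈ p ++ x :: s, Q y ∧ ¬ P y) →
      (p ++ x :: s).countP (fun a => decide (P a)) + (p ++ x :: s).countP (fun a => decide (Q a))
        < (p ++ x :: s).length) :
    Insertable adj e (p ++ x :: s) := by
  by_contra hno
  have hslot := isChain_slot h.symm hc hno
  have hplast : ∀ y ∈ p.getLast?, adj y e := by
    intro y hy
    have hyx : adj y x := (List.isChain_append.1 hc).2.2 y hy x (by simp)
    have hyP : ¬ P y := fun hyP => h.left hyP hxP hyx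
    exact h.center.2 ⟨hyP, fun hQ => hyP ((hpPQ y (List.mem_of_mem_getLast? hy)).2 hQ)⟩
  obtain ⟨g, r, hgr, hg, hr⟩ := List.exists_maximal_prefix (fun y => ¬ (P y ↔ Q y)) (x :: s)
  have hgx : x ∈ g.head? := by
    cases g with
    | nil =>
      rw [List.nil_append] at hgr
      subst hgr
      exact absurd (hr x (by simp)) (by simp [hxP, hxQ])
    | cons y g =>
      obtain rfl : x = y := by simpa using congrArg List.head? hgr
      simp
  have hgne : g ≠ [] := by rintro rfl; simp at hgx
  obtain ⟨z, hz⟩ : ∃ z, z ∈ g.getLast? := ⟨_, List.getLast_mem_getLast? hgne⟩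
  rw [hgr] at hc hP hD hno hslot
  have hzPQ := hg z (List.mem_of_mem_getLast? hz)
  have hrhead : ∀ y ∈ r.head?, adj y e := by
    intro y hy
    have hzy : adj z y := (List.isChain_append.1 (List.isChain_append.1 hc).2.1).2.2 z hz y hy
    have hyPQ := not_not.1 (hr y hy)
    have hyP : ¬ P y := fun hyP => by
      by_cases hzP : P z
      · exact h.left hzP hyP hzy
      · exact h.right (by tauto) (hyPQ.1 hyP) hzy
    exact h.center.2 ⟨hyP, fun hQ => hyP (hyPQ.2 hQ)⟩
  -- A point on the second line only is adjacent to `x`. Were it first in the chain or just after a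
  -- free point, the stretch between it and `x` could be reversed.
  have hstart : ∀ p' q' : List V, p ++ (g ++ r) = p' ++ q' → (∀ w ∈ p'.getLast?, adj w e) →
      ∀ y ∈ q'.head?, ¬ (Q y ∧ ¬ P y) := fun p' q' heq hp' y hy hy' =>
    hno (insertable_of_two_starts h.symm hc heq hplast hp'
      (by rwa [List.head?_append_of_ne_nil _ hgne]) hy (h.cross hxP hxQ hy'.1 hy'.2)
      (h.left hxP hxP))
  -- The mirror image, with the right border of `g` and `z` in place of the left border and `x`.
  have hend : ∀ p' q' : List V, p ++ (g ++ r) = p' ++ q' → (∀ w ∈ q'.head?, adj w e) →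
      ∀ y ∈ p'.getLast?, ¬ adj z y := by
    intro p' q' heq hq' y hy hzy
    rw [← List.append_assoc] at hc heq hno
    refine hno (insertable_of_two_ends h.symm hc heq hrhead hq'
      (by rwa [List.getLast?_append_of_ne_nil _ hgne]) hy hzy fun hzz => ?_)
    by_cases hzP : P z
    · exact h.left hzP hzP hzz
    · exact h.right (by tauto) (by tauto) hzz
  have hhead : ∀ y ∈ (p ++ (g ++ r)).head?, P y := by
    intro y hy
    by_contra hyP
    by_cases hyQ : Q y
    · exact hstart [] _ rfl (by simp) y hy ⟨hyQ, hyP⟩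
    · refine hno (insertable_of_slot (p := []) hc (by simp) fun w hw => ?_)
      obtain rfl := Option.mem_unique hy hw
      exact h.symm (h.center.2 ⟨hyP, hyQ⟩)
  have hlast : ∀ y ∈ (p ++ (g ++ r)).getLast?, ¬ adj y e := by
    intro y hy hye
    rw [← List.append_nil (p ++ (g ++ r))] at hc hno
    refine hno (insertable_of_slot hc (fun w hw => ?_) (by simp))
    obtain rfl := Option.mem_unique hy hw
    exact hye
  -- If `z` is on the first line only, it is adjacent to every point that is on the second line
  -- only. Then membership in the first line alternates along the whole chain and holds at both
  -- ends, so that line has more than half of the points.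
  by_cases hzP : P z
  · have hzQ : ¬ Q z := by tauto
    refine absurd hP (not_le.2 (length_lt_two_mul_countP P _ (by simp [hgne]) ?_ hhead ?_))
    · rw [List.isChain_iff_forall_rel_of_append_cons_cons] at hslot ⊢
      intro y w p' q' heq hiff
      obtain ⟨hyw, hyw'⟩ := hslot heq
      have heq' : p ++ (g ++ r) = (p' ++ [y]) ++ w :: q' := by simpa using heq
      by_cases hyP : P y
      · exact h.left hyP (hiff.1 hyP) hyw
      have hwP : ¬ P w := fun h => hyP (hiff.2 h)
      by_cases hyQ : Q y
      · have hwQ : ¬ Q w := fun hwQ => h.right hyQ hwQ hyw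
        exact hend _ _ heq' (by simpa using h.center.2 ⟨hwP, hwQ⟩) y (by simp)
          (h.cross hzP hzQ hyQ hyP)
      · have hye := h.center.2 ⟨hyP, hyQ⟩
        refine hstart _ _ heq' (by simpa using hye) w (by simp) ⟨?_, hwP⟩
        by_contra hwQ
        exact hyw' ⟨hye, h.center.2 ⟨hwP, hwQ⟩⟩
    · intro y hy
      by_contra hyP
      by_cases hyQ : Q y
      · exact hend (p ++ (g ++ r)) [] (by simp) (by simp) y hy (h.cross hzP hzQ hyQ hyP)
      · exact hlast y hy (h.center.2 ⟨hyP, hyQ⟩)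
  · have hzQ : Q z := by tauto
    -- Otherwise let `a` be the first point of `r` on exactly one line. By `hstart` it is on the
    -- first line, hence adjacent to `z`. By `hend` it has a successor that is not free; this is
    -- then on the second line only, and the block `g` can be moved in between.
    have hrPQ : ∀ y ∈ r, P y ↔ Q y := by
      by_contra! hex
      obtain ⟨q, a, t, rfl, ha, hq⟩ := List.exists_split_of_exists_mem
        (p := fun y => ¬ (P y ↔ Q y)) (l := r) (by obtain ⟨y, hy, hy'⟩ := hex; exact ⟨y, hy, by tauto⟩)
      have hqne : q ≠ [] := by
        rintro rfl
        exact hr a (by simp) ha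
      rw [List.head?_append_of_ne_nil _ hqne] at hrhead
      have hc1 := (List.isChain_append.1 (List.isChain_append.1 hc).2.1).2.1
      have hqlast : ∀ y ∈ q.getLast?, adj y e := by
        intro y hy
        have hya : adj y a := (List.isChain_append.1 hc1).2.2 y hy a (by simp)
        have hyPQ := not_not.1 (hq y (List.mem_of_mem_getLast? hy))
        by_cases hyP : P y
        · by_cases haP : P a
          · exact absurd hya (h.left hyP haP)
          · exact absurd hya (h.right (hyPQ.1 hyP) (by tauto))
        · exact h.center.2 ⟨hyP, fun h => hyP (hyPQ.2 h)⟩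
      have ha' := hstart (p ++ (g ++ q)) (a :: t) (by simp) (by
        rwa [← List.append_assoc, List.getLast?_append_of_ne_nil _ hqne]) a (by simp)
      have haP : P a := by tauto
      have haQ : ¬ Q a := by tauto
      have hza : adj z a := h.symm (h.cross haP haQ hzQ hzP)
      cases t with
      | nil => exact hend _ [] (List.append_nil _).symm (by simp) a (by simp) hza
      | cons b t =>
        have hab : adj a b := by
          rw [List.isChain_append_cons_cons] at hc1
          exact hc1.2.1
        have hbP : ¬ P b := fun hbP => h.left haP hbP hab
        by_cases hbQ : Q b
        · exact hno (h.insertable_of_move hc hgx hz hxP hxQ hzP hzQ haP haQ hbP hbQ hplast hrhead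
            hqne)
        · exact hend (p ++ (g ++ (q ++ [a]))) (b :: t) (by simp)
            (by simpa using h.center.2 ⟨hbP, hbQ⟩) a (by simp) hza
    have halt : ∀ l₁ l₂ l₃ : List V, p ++ (g ++ r) = l₁ ++ (l₂ ++ l₃) → (∀ y ∈ l₂, P y ↔ Q y) →
        l₂.IsChain fun a b => ¬ (P a ↔ P b) := by
      intro l₁ l₂ l₃ heq hl
      rw [heq] at hslot
      refine (List.isChain_append.1 (List.isChain_append.1 hslot).2.1).1.imp_of_mem_imp ?_
      rintro y w hy hw ⟨hyw, hyw'⟩ hiff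
      have h1 := hl y hy
      have h2 := hl w hw
      by_cases hyP : P y
      · exact h.left hyP (hiff.1 hyP) hyw
      · exact hyw' ⟨h.center.2 (by tauto), h.center.2 (by tauto)⟩
    have hcp := two_mul_countP_eq_length P p (halt [] p _ rfl hpPQ) fun y hy w hw => by
      have hyP := hhead y (by
        rwa [List.head?_append_of_ne_nil _ (by rintro rfl; simp at hy)])
      have := h.center.1 (hplast w hw)
      tauto
    have hcr := two_mul_countP_eq_length P r (halt (p ++ g) r [] (by simp) hrPQ) fun y hy w hw => by
      have hyP := h.center.1 (hrhead y hy)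
      have hw1 := hlast w (by
        have : r ≠ [] := by rintro rfl; simp at hy
        rwa [List.getLast?_append_of_ne_nil _ (by simp [this]),
          List.getLast?_append_of_ne_nil _ this])
      rw [h.center] at hw1
      have hw2 := hrPQ w (List.mem_of_mem_getLast? hw)
      tauto
    have h1 := countP_congr_of_iff hpPQ
    have h2 := countP_congr_of_iff hrPQ
    have h3 := countP_add_countP_of_not_iff hg
    have h4 := hD ⟨z, by simp [List.mem_of_mem_getLast? hz], hzQ, hzP⟩
    -- Each line has exactly half of `p` and half of `r`, and each point of `g` is on exactly one
    -- line. The two counts thus add up to the full length, against the strict inequality.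
    simp only [List.countP_append, List.length_append] at h4
    omega

/-- A point can be inserted into a chain, provided that the two lines through it are not too
large. -/
theorem IsLinePair.insertable {adj : V → V → Prop} {P Q : V → Prop} {e : V}
    [DecidablePred P] [DecidablePred Q] (h : IsLinePair adj P Q e) {l : List V}
    (hc : l.IsChain adj) (hP : 2 * l.countP (fun a => decide (P a)) ≤ l.length)
    (hQ : 2 * l.countP (fun a => decide (Q a)) ≤ l.length)
    (hD : (∃ x ∈ l, P x ∧ ¬ Q x) → (∃ y ∈ l, Q y ∧ ¬ P y) →
      l.countP (fun a => decide (P a)) + l.countP (fun a => decide (Q a)) < l.length) :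
    Insertable adj e l := by
  by_cases hPQ : ∀ x ∈ l, P x ↔ Q x
  · by_contra hno
    exact absurd hP (not_le.2 (h.length_lt_of_forall_iff hc hno hPQ))
  · obtain ⟨p, x, s, rfl, hx, hp⟩ := List.exists_split_of_exists_mem
      (p := fun y => ¬ (P y ↔ Q y)) (l := l) (by simpa using hPQ)
    have hx_mem : x ∈ p ++ x :: s := by simp
    by_cases hxP : P x
    · have hxQ : ¬ Q x := by tauto
      exact h.insertable_aux hc (fun y hy => not_not.1 (hp y hy)) hxP hxQ hP
        (hD ⟨x, hx_mem, hxP, hxQ⟩)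
    · have hxQ : Q x := by tauto
      refine h.swap.insertable_aux hc (fun y hy => (not_not.1 (hp y hy)).symm) hxQ hxP hQ
        fun hy => ?_
      have := hD hy ⟨x, hx_mem, hxQ, hxP⟩
      omega

end Insertion

/-! ### Balanced point sets and their induction -/

section Good

variable {V : Type*} {α : Type*} {β : Type*}

/-- The points of `A` on the same `f`-line as `e`. -/
def lineThrough [DecidableEq α] (f : V → α) (A : Finset V) (e : V) : Finset V :=
  A.filter fun x => f x = f e

/-- The points of `A` occupy all four cells of a two by two grid, and no others. -/
def IsFullSquare (r : V → α) (c : V → β) (A : Finset V) : Prop :=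
  ∃ a ∈ A, ∃ b ∈ A, (∃ x ∈ A, r x = r a ∧ c x = c b) ∧ (∃ y ∈ A, r y = r b ∧ c y = c a) ∧
    r a ≠ r b ∧ c a ≠ c b ∧ ∀ z ∈ A, (r z = r a ∨ r z = r b) ∧ (c z = c a ∨ c z = c b)

/-- The point `e` is neither alone in its row nor in its column, even up to parallel points. -/
def IsGridCorner (r : V → α) (c : V → β) (A : Finset V) (e : V) : Prop :=
  (∃ x ∈ A, r x = r e ∧ c x ≠ c e) ∧ ∃ y ∈ A, c y = c e ∧ r y ≠ r e

/-- Numerical conditions under which a Hamiltonian path exists. -/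
structure IsBalanced [DecidableEq α] [DecidableEq β] (r : V → α) (c : V → β) (A : Finset V) :
    Prop where
  row : ∀ e ∈ A, 2 * (lineThrough r A e).card ≤ A.card + 1
  col : ∀ e ∈ A, 2 * (lineThrough c A e).card ≤ A.card + 1
  corner : ∀ e ∈ A, IsGridCorner r c A e →
    (lineThrough r A e).card + (lineThrough c A e).card ≤ A.card
  not_square : ¬ IsFullSquare r c A

theorem IsFullSquare.swap {r : V → α} {c : V → β} {A : Finset V} (h : IsFullSquare r c A) :
    IsFullSquare c r A := by
  obtain ⟨a, ha, b, hb, ⟨x, hx, hx1, hx2⟩, ⟨y, hy, hy1, hy2⟩, h1, h2, h3⟩ := h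
  exact ⟨a, ha, b, hb, ⟨y, hy, hy2, hy1⟩, ⟨x, hx, hx2, hx1⟩, h2, h1, fun z hz => (h3 z hz).symm⟩

theorem IsGridCorner.swap {r : V → α} {c : V → β} {A : Finset V} {e : V} (h : IsGridCorner r c A e) :
    IsGridCorner c r A e := ⟨h.2, h.1⟩

theorem IsGridCorner.mono {r : V → α} {c : V → β} {A B : Finset V} {e : V} (h : IsGridCorner r c A e)
    (hAB : A ⊆ B) : IsGridCorner r c B e := by
  obtain ⟨⟨x, hx, hx'⟩, y, hy, hy'⟩ := h
  exact ⟨⟨x, hAB hx, hx'⟩, y, hAB hy, hy'⟩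

/-- If `e` shares its row and its column with remaining points, it falls into one of the four cells
already present. -/
theorem IsFullSquare.of_erase [DecidableEq V] {r : V → α} {c : V → β} {A : Finset V} {e : V}
    (h : IsFullSquare r c (A.erase e)) (hr : ∃ x ∈ A, x ≠ e ∧ r x = r e)
    (hc : ∃ x ∈ A, x ≠ e ∧ c x = c e) : IsFullSquare r c A := by
  obtain ⟨a, ha, b, hb, ⟨x, hx, hx'⟩, ⟨y, hy, hy'⟩, h1, h2, h3⟩ := h
  have hsub := Finset.erase_subset e A
  refine ⟨a, hsub ha, b, hsub hb, ⟨x, hsub hx, hx'⟩, ⟨y, hsub hy, hy'⟩, h1, h2, fun z hz => ?_⟩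
  by_cases hze : z = e
  · subst hze
    obtain ⟨u, hu, hue, hur⟩ := hr
    obtain ⟨v, hv, hve, hvc⟩ := hc
    have hu' := h3 u (Finset.mem_erase.2 ⟨hue, hu⟩)
    have hv' := h3 v (Finset.mem_erase.2 ⟨hve, hv⟩)
    rw [hur] at hu'
    rw [hvc] at hv'
    exact ⟨hu'.1, hv'.2⟩
  · exact h3 z (Finset.mem_erase.2 ⟨hze, hz⟩)

theorem IsFullSquare.isGridCorner {r : V → α} {c : V → β} {A : Finset V} (h : IsFullSquare r c A)
    {e : V} (he : e ∈ A) : IsGridCorner r c A e := by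
  obtain ⟨a, ha, b, hb, ⟨x, hx, hx1, hx2⟩, ⟨y, hy, hy1, hy2⟩, h1, h2, h3⟩ := h
  obtain ⟨hr | hr, hc | hc⟩ := h3 e he
  · exact ⟨⟨x, hx, by rw [hr, hx1], by rw [hc, hx2]; exact h2.symm⟩,
      y, hy, by rw [hc, hy2], by rw [hr, hy1]; exact h1.symm⟩
  · exact ⟨⟨a, ha, by rw [hr], by rw [hc]; exact h2⟩, b, hb, by rw [hc], by rw [hr]; exact h1.symm⟩
  · exact ⟨⟨b, hb, by rw [hr], by rw [hc]; exact h2.symm⟩, a, ha, by rw [hc], by rw [hr]; exact h1⟩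
  · exact ⟨⟨y, hy, by rw [hr, hy1], by rw [hc, hy2]; exact h2⟩,
      x, hx, by rw [hc, hx2], by rw [hr, hx1]; exact h1⟩

theorem IsGridCorner.not_isFullSquare_erase [DecidableEq V] {r : V → α} {c : V → β} {A : Finset V}
    {e : V} (h : IsGridCorner r c A e) (hA : ¬ IsFullSquare r c A) :
    ¬ IsFullSquare r c (A.erase e) := by
  obtain ⟨⟨x, hx, hxr, hxc⟩, y, hy, hyc, hyr⟩ := h
  exact fun h' => hA (h'.of_erase ⟨x, hx, by rintro rfl; exact hxc rfl, hxr⟩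
    ⟨y, hy, by rintro rfl; exact hyr rfl, hyc⟩)

theorem not_isFullSquare_erase_of_ne [DecidableEq V] {r : V → α} {c : V → β} {A : Finset V}
    {e x : V} (hA : ¬ IsFullSquare r c A) (h : IsFullSquare r c (A.erase e)) (hx : x ∈ A)
    (hxe : x ≠ e) : ¬ IsFullSquare r c (A.erase x) :=
  ((h.isGridCorner (Finset.mem_erase.2 ⟨hxe, hx⟩)).mono (Finset.erase_subset e A)).not_isFullSquare_erase
    hA

theorem IsFullSquare.four_le_card {r : V → α} {c : V → β} {A : Finset V}
    (h : IsFullSquare r c A) : 4 ≤ A.card := by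
  classical
  obtain ⟨a, ha, b, hb, ⟨x, hx, hx1, hx2⟩, ⟨y, hy, hy1, hy2⟩, h1, h2, h3⟩ := h
  have hsub : ({a, b, x, y} : Finset V) ⊆ A := by
    simp [Finset.insert_subset_iff, ha, hb, hx, hy]
  have hab : a ≠ b := by rintro rfl; exact h1 rfl
  have hax : a ≠ x := by rintro rfl; exact h2 hx2
  have hay : a ≠ y := by rintro rfl; exact h1 hy1
  have hbx : b ≠ x := by rintro rfl; exact h1 hx1.symm
  have hby : b ≠ y := by rintro rfl; exact h2 hy2.symm
  have hxy : x ≠ y := by rintro rfl; exact h1 (hx1.symm.trans hy1)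
  calc 4 = ({a, b, x, y} : Finset V).card := by
        rw [Finset.card_insert_of_notMem (by simp [hab, hax, hay]),
          Finset.card_insert_of_notMem (by simp [hbx, hby]),
          Finset.card_insert_of_notMem (by simp [hxy]), Finset.card_singleton]
    _ ≤ A.card := Finset.card_le_card hsub

theorem isLinePair_of_lines (r : V → α) (c : V → β) (e : V) :
    IsLinePair (fun x y => r x ≠ r y ∧ c x ≠ c y) (fun x => r x = r e) (fun x => c x = c e) e where
  symm h := ⟨h.1.symm, h.2.symm⟩
  left h1 h2 h := h.1 (h1.trans h2.symm)
  right h1 h2 h := h.2 (h1.trans h2.symm)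
  cross h1 h2 h3 h4 := ⟨fun h => h4 (h.symm.trans h1), fun h => h2 (h.trans h3)⟩
  center := Iff.rfl

/-! ### Line sizes and the choice of the deleted point -/

variable [DecidableEq α] [DecidableEq β]

theorem IsBalanced.swap {r : V → α} {c : V → β} {A : Finset V} (h : IsBalanced r c A) :
    IsBalanced c r A where
  row := h.col
  col := h.row
  corner e he hc := by
    rw [add_comm]
    exact h.corner e he hc.swap
  not_square hs := h.not_square hs.swap

theorem mem_lineThrough {f : V → α} {A : Finset V} {e x : V} :
    x ∈ lineThrough f A e ↔ x ∈ A ∧ f x = f e := by simp [lineThrough]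

theorem lineThrough_subset (f : V → α) (A : Finset V) (e : V) : lineThrough f A e ⊆ A :=
  Finset.filter_subset _ _

theorem card_lineThrough_erase_le [DecidableEq V] (f : V → α) (A : Finset V) (e x : V) :
    (lineThrough f (A.erase e) x).card ≤ (lineThrough f A x).card :=
  Finset.card_le_card (Finset.filter_subset_filter _ (Finset.erase_subset _ _))

theorem card_lineThrough_erase_lt [DecidableEq V] {f : V → α} {A : Finset V} {e x : V}
    (he : e ∈ A) (hf : f e = f x) :
    (lineThrough f (A.erase e) x).card < (lineThrough f A x).card := by
  apply Finset.card_lt_card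
  refine ⟨Finset.filter_subset_filter _ (Finset.erase_subset _ _), fun h => ?_⟩
  have := h (mem_lineThrough.2 ⟨he, hf⟩)
  simp [mem_lineThrough] at this

theorem card_lineThrough_add_le [DecidableEq V] {f : V → α} {A : Finset V} {e x : V}
    (hf : f e ≠ f x) : (lineThrough f A e).card + (lineThrough f A x).card ≤ A.card := by
  rw [← Finset.card_union_of_disjoint]
  · exact Finset.card_le_card (Finset.union_subset (lineThrough_subset _ _ _)
      (lineThrough_subset _ _ _))
  · rw [Finset.disjoint_left]
    intro z hz hz'
    exact hf ((mem_lineThrough.1 hz).2.symm.trans (mem_lineThrough.1 hz').2)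

theorem mem_or_mem_of_card_lineThrough_add [DecidableEq V] {f : V → α} {A : Finset V} {e x : V}
    (hf : f e ≠ f x) (h : (lineThrough f A e).card + (lineThrough f A x).card = A.card) {z : V}
    (hz : z ∈ A) : f z = f e ∨ f z = f x := by
  by_contra! hne
  have hlt : (lineThrough f (A.erase z) e).card + (lineThrough f (A.erase z) x).card
    ≤ (A.erase z).card := card_lineThrough_add_le hf
  have h1 : ∀ y, f z ≠ f y → lineThrough f (A.erase z) y = lineThrough f A y := by
    intro y hy
    ext w
    simp only [mem_lineThrough, Finset.mem_erase]
    refine ⟨fun h => ⟨h.1.2, h.2⟩, fun h => ⟨⟨?_, h.1⟩, h.2⟩⟩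
    rintro rfl
    exact hy h.2
  rw [h1 e hne.1, h1 x hne.2] at hlt
  have := Finset.card_erase_lt_of_mem hz
  omega

theorem exists_mem_lineThrough_inter [DecidableEq V] {r : V → α} {c : V → β} {A : Finset V}
    {x y : V} (h : A.card < (lineThrough r A x).card + (lineThrough c A y).card) :
    ∃ e ∈ A, r e = r x ∧ c e = c y := by
  by_contra! hne
  rw [← Finset.card_union_of_disjoint] at h
  · exact absurd h (not_lt.2 (Finset.card_le_card (Finset.union_subset (lineThrough_subset _ _ _)
      (lineThrough_subset _ _ _))))
  · rw [Finset.disjoint_left]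
    intro z hz hz'
    rw [mem_lineThrough] at hz hz'
    exact hne z hz.1 hz.2 hz'.2

/-- Two tight corners share a row or a column. -/
theorem IsBalanced.tight_corners_meet [DecidableEq V] {r : V → α} {c : V → β} {A : Finset V}
    (h : IsBalanced r c A) {e f : V} (he : e ∈ A) (hf : f ∈ A) (hec : IsGridCorner r c A e)
    (het : (lineThrough r A e).card + (lineThrough c A e).card = A.card)
    (hft : (lineThrough r A f).card + (lineThrough c A f).card = A.card) :
    r e = r f ∨ c e = c f := by
  by_contra! hne
  -- The four line sizes sum to twice `A.card`, so both disjointness bounds are equalities: two rows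
  -- and two columns cover `A`. The corner `e` supplies the other two cells of a full square.
  have h1 := card_lineThrough_add_le (A := A) hne.1
  have h2 := card_lineThrough_add_le (A := A) hne.2
  have hr : ∀ z ∈ A, r z = r e ∨ r z = r f := fun z =>
    mem_or_mem_of_card_lineThrough_add hne.1 (by omega)
  have hc : ∀ z ∈ A, c z = c e ∨ c z = c f := fun z =>
    mem_or_mem_of_card_lineThrough_add hne.2 (by omega)
  obtain ⟨⟨x, hx, hxr, hxc⟩, y, hy, hyc, hyr⟩ := hec
  exact h.not_square ⟨e, he, f, hf, ⟨x, hx, hxr, (hc x hx).resolve_left hxc⟩,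
    ⟨y, hy, (hr y hy).resolve_left hyr, hyc⟩, hne.1, hne.2, fun z hz => ⟨hr z hz, hc z hz⟩⟩

/-- A tight corner lies on every tight row. -/
theorem IsBalanced.tight_corner_mem_row [DecidableEq V] {r : V → α} {c : V → β} {A : Finset V}
    (h : IsBalanced r c A) {e w : V} (he : e ∈ A)
    (het : (lineThrough r A e).card + (lineThrough c A e).card = A.card)
    (hw : 2 * (lineThrough r A w).card = A.card + 1) : r e = r w := by
  by_contra hne
  have h1 := card_lineThrough_add_le (A := A) hne
  have h2 := h.col e he
  -- Disjointness of the two rows and tightness at `e` make the column of `e` at least as large as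
  -- the row of `w`, so these lines are too large to be disjoint. Their common point `g` breaks the
  -- corner bound, unless the row lies strictly inside the column, which the sizes also exclude.
  obtain ⟨g, hg, hgr, hgc⟩ := exists_mem_lineThrough_inter (r := r) (c := c) (A := A) (x := w)
    (y := e) (by omega)
  have hgR : lineThrough r A g = lineThrough r A w := by simp [lineThrough, hgr]
  have hgC : lineThrough c A g = lineThrough c A e := by simp [lineThrough, hgc]
  by_cases hx : ∃ x ∈ A, r x = r g ∧ c x ≠ c g
  · have := h.corner g hg ⟨hx, e, he, hgc.symm, by rwa [hgr]⟩
    rw [hgR, hgC] at this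
    omega
  · push Not at hx
    have : (lineThrough r A w).card < (lineThrough c A e).card := by
      refine Finset.card_lt_card ⟨fun z hz => ?_, fun hsub => ?_⟩
      · rw [mem_lineThrough] at hz ⊢
        exact ⟨hz.1, by rw [← hgc]; exact hx z hz.1 (by rw [hz.2, hgr])⟩
      · exact hne (mem_lineThrough.1 (hsub (mem_lineThrough.2 ⟨he, rfl⟩))).2
    omega

/-- Every bound loses one on its right-hand side. Bounds that are not tight absorb this; a tight one
survives because `e` lies on a line it counts. -/
theorem IsBalanced.erase [DecidableEq V] {r : V → α} {c : V → β} {A : Finset V}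
    (h : IsBalanced r c A) {e : V} (he : e ∈ A)
    (hr : ∀ w ∈ A, 2 * (lineThrough r A w).card = A.card + 1 → r e = r w)
    (hc : ∀ w ∈ A, 2 * (lineThrough c A w).card = A.card + 1 → c e = c w)
    (hf : ∀ f ∈ A, IsGridCorner r c A f →
      (lineThrough r A f).card + (lineThrough c A f).card = A.card → r e = r f ∨ c e = c f)
    (hs : ¬ IsFullSquare r c (A.erase e)) : IsBalanced r c (A.erase e) := by
  have hcard := Finset.card_erase_add_one he
  refine ⟨fun w hw => ?_, fun w hw => ?_, fun f hfA hcor => ?_, hs⟩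
  · have hw := Finset.mem_of_mem_erase hw
    have h1 := h.row w hw
    have h2 := card_lineThrough_erase_le r A e w
    by_cases ht : 2 * (lineThrough r A w).card = A.card + 1
    · have := card_lineThrough_erase_lt he (hr w hw ht)
      omega
    · omega
  · have hw := Finset.mem_of_mem_erase hw
    have h1 := h.col w hw
    have h2 := card_lineThrough_erase_le c A e w
    by_cases ht : 2 * (lineThrough c A w).card = A.card + 1
    · have := card_lineThrough_erase_lt he (hc w hw ht)
      omega
    · omega
  · have hfA := Finset.mem_of_mem_erase hfA
    have hcor := hcor.mono (Finset.erase_subset e A)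
    have h1 := h.corner f hfA hcor
    have h2 := card_lineThrough_erase_le r A e f
    have h3 := card_lineThrough_erase_le c A e f
    by_cases ht : (lineThrough r A f).card + (lineThrough c A f).card = A.card
    · obtain hh | hh := hf f hfA hcor ht
      · have := card_lineThrough_erase_lt he hh
        omega
      · have := card_lineThrough_erase_lt he hh
        omega
    · omega

theorem tight_lines_eq [DecidableEq V] {f : V → α} {A : Finset V} {x y : V}
    (hx : 2 * (lineThrough f A x).card = A.card + 1)
    (hy : 2 * (lineThrough f A y).card = A.card + 1) : f x = f y := by
  by_contra hne
  have := card_lineThrough_add_le (A := A) hne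
  omega

theorem exists_ne_of_tight {f : V → α} {A : Finset V} {e w : V} (hA : 3 ≤ A.card)
    (hw : 2 * (lineThrough f A w).card = A.card + 1) : ∃ x ∈ A, x ≠ e ∧ f x = f w := by
  obtain ⟨x, hx, hxe⟩ := Finset.exists_mem_ne (s := lineThrough f A w) (by omega) e
  rw [mem_lineThrough] at hx
  exact ⟨x, hx.1, hxe, hx.2⟩

/-- When no corner is tight and some row is tight, a point of this row can be removed. -/
theorem IsBalanced.exists_erase_of_tight_row [DecidableEq V] {r : V → α} {c : V → β}
    {A : Finset V} (h : IsBalanced r c A) {w : V} (hwA : w ∈ A)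
    (hf : ∀ f ∈ A, IsGridCorner r c A f →
      (lineThrough r A f).card + (lineThrough c A f).card ≠ A.card)
    (hw : 2 * (lineThrough r A w).card = A.card + 1) : ∃ e ∈ A, IsBalanced r c (A.erase e) := by
  have hr : ∀ e, r e = r w → ∀ v ∈ A, 2 * (lineThrough r A v).card = A.card + 1 → r e = r v :=
    fun e he v _ hv => he.trans (tight_lines_eq hw hv)
  by_cases hcol : ∃ v ∈ A, 2 * (lineThrough c A v).card = A.card + 1
  · obtain ⟨v, hvA, hv⟩ := hcol
    obtain ⟨e, he, her, hec⟩ := exists_mem_lineThrough_inter (r := r) (c := c) (A := A) (x := w)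
      (y := v) (by omega)
    refine ⟨e, he, h.erase he (hr e her) (fun u _ hu => hec.trans (tight_lines_eq hv hu))
      (fun f hfA hfc hft => absurd hft (hf f hfA hfc)) fun hs => h.not_square ?_⟩
    have h4 := hs.four_le_card.trans (Finset.card_erase_le)
    exact hs.of_erase (by rw [her]; exact exists_ne_of_tight (by omega) hw)
      (by rw [hec]; exact exists_ne_of_tight (by omega) hv)
  · push Not at hcol
    have key : ∀ e ∈ A, r e = r w → ¬ IsFullSquare r c (A.erase e) →
        IsBalanced r c (A.erase e) := fun e he her hs =>
      h.erase he (hr e her) (fun v hvA hv => absurd hv (hcol v hvA))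
        (fun f hfA hfc hft => absurd hft (hf f hfA hfc)) hs
    by_cases hs : IsFullSquare r c (A.erase w)
    · have h4 := hs.four_le_card.trans (Finset.card_erase_le)
      obtain ⟨x, hxA, hxw, hxr⟩ := exists_ne_of_tight (e := w) (by omega) hw
      exact ⟨x, hxA, key x hxA hxr (not_isFullSquare_erase_of_ne h.not_square hs hxA hxw)⟩
    · exact ⟨w, hwA, key w hwA rfl hs⟩

/-- A tight corner, if there is one, meets all tight lines and tight corners. Failing that, a point
of a tight line is taken, common to a tight row and a tight column if both exist; failing that, any
point. If the deletion would leave a full square, a different choice avoids it or the set was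
already a full square. -/
theorem IsBalanced.exists_erase [DecidableEq V] {r : V → α} {c : V → β} {A : Finset V}
    (h : IsBalanced r c A) (hA : A.Nonempty) : ∃ e ∈ A, IsBalanced r c (A.erase e) := by
  by_cases hf : ∃ f ∈ A, IsGridCorner r c A f ∧
      (lineThrough r A f).card + (lineThrough c A f).card = A.card
  · obtain ⟨e, he, hec, het⟩ := hf
    exact ⟨e, he, h.erase he (fun w _ hw => h.tight_corner_mem_row he het hw)
      (fun w _ hw => h.swap.tight_corner_mem_row he (by omega) hw)
      (fun f hfA _ hft => h.tight_corners_meet he hfA hec het hft)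
      (hec.not_isFullSquare_erase h.not_square)⟩
  push Not at hf
  by_cases hrow : ∃ w ∈ A, 2 * (lineThrough r A w).card = A.card + 1
  · obtain ⟨w, hwA, hw⟩ := hrow
    exact h.exists_erase_of_tight_row hwA hf hw
  by_cases hcol : ∃ w ∈ A, 2 * (lineThrough c A w).card = A.card + 1
  · obtain ⟨w, hwA, hw⟩ := hcol
    obtain ⟨e, he, hbal⟩ := h.swap.exists_erase_of_tight_row hwA
      (fun f hfA hfc => by rw [add_comm]; exact hf f hfA hfc.swap) hw
    exact ⟨e, he, hbal.swap⟩
  push Not at hrow hcol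
  have key : ∀ e ∈ A, ¬ IsFullSquare r c (A.erase e) → IsBalanced r c (A.erase e) :=
    fun e he hs => h.erase he (fun v hvA hv => absurd hv (hrow v hvA))
      (fun v hvA hv => absurd hv (hcol v hvA))
      (fun f hfA hfc hft => absurd hft (hf f hfA hfc)) hs
  obtain ⟨e, he⟩ := hA
  by_cases hs : IsFullSquare r c (A.erase e)
  · obtain ⟨x, hx⟩ := Finset.card_pos.1 (lt_of_lt_of_le (by norm_num) hs.four_le_card)
    rw [Finset.mem_erase] at hx
    exact ⟨x, hx.2, key x hx.2 (not_isFullSquare_erase_of_ne h.not_square hs hx.2 hx.1)⟩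
  · exact ⟨e, he, key e he hs⟩

theorem card_lineThrough_eq_countP {f : V → α} {A : Finset V} {e : V} {l : List V}
    (hl : l.Perm A.toList) :
    (lineThrough f A e).card = l.countP (fun x => decide (f x = f e)) := by
  rw [hl.countP_eq, ← Multiset.coe_countP, Finset.coe_toList, Multiset.countP_eq_card_filter]
  rfl

/-- A balanced set of points can be arranged so that consecutive points share no line. -/
theorem IsBalanced.exists_isChain [DecidableEq V] {r : V → α} {c : V → β} (A : Finset V)
    (h : IsBalanced r c A) :
    ∃ l : List V, l.Perm A.toList ∧ l.IsChain fun x y => r x ≠ r y ∧ c x ≠ c y := by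
  induction hn : A.card generalizing A with
  | zero =>
    obtain rfl := Finset.card_eq_zero.1 hn
    exact ⟨[], by simp, by simp⟩
  | succ n ih =>
    obtain ⟨e, he, hbal⟩ := h.exists_erase (Finset.card_pos.1 (by omega))
    obtain ⟨l, hl, hc⟩ := ih (A.erase e) hbal (by rw [Finset.card_erase_of_mem he]; omega)
    have hperm : (e :: l).Perm A.toList := by
      refine (hl.cons e).trans ?_
      rw [← Multiset.coe_eq_coe, ← Multiset.cons_coe, Finset.coe_toList, Finset.coe_toList,
        Finset.erase_val, Multiset.cons_erase he]
    have hlen : l.length + 1 = A.card := by simpa using hperm.length_eq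
    have hmem : ∀ x ∈ l, x ∈ A := fun x hx => by
      simpa using hperm.subset (List.mem_cons_of_mem e hx)
    have hr := card_lineThrough_eq_countP (f := r) (e := e) hperm
    have hc' := card_lineThrough_eq_countP (f := c) (e := e) hperm
    -- The point `e` counts once on each of its lines; this turns the bounds for `A` into the ones
    -- needed for `l`, with strict inequality at a corner.
    rw [List.countP_cons_of_pos (by simp)] at hr hc'
    have h1 := h.row e he
    have h2 := h.col e he
    obtain ⟨l', hl', hch⟩ := (isLinePair_of_lines r c e).insertable hc (by omega) (by omega)
      fun ⟨x, hx, hx'⟩ ⟨y, hy, hy'⟩ => by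
        have := h.corner e he ⟨⟨x, hmem x hx, hx'⟩, y, hmem y hy, hy'⟩
        omega
    exact ⟨l', hl'.trans hperm, hch⟩

end Good

/-! ### Grid coordinates, toughness and Hamiltonian paths -/

section Toughness

/-- A skew graph has coordinates such that adjacency means that both coordinates differ. -/
theorem SimpleGraph.IsSkew.exists_coordinates {V : Type u} {G : SimpleGraph V}
    (hG : SimpleGraph.IsSkew.{u, v, w} G) :
    ∃ (α : Type v) (r c : V → α), ∀ x y, G.Adj x y ↔ r x ≠ r y ∧ c x ≠ c y := by
  obtain ⟨α, β, H, ⟨X, hX⟩, ⟨φ⟩⟩ := hG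
  have hlink : ∀ e : H.edgeSet, ∃ a b, H.IsLink e a b ∧ a ∈ X ∧ b ∉ X := by
    rintro ⟨e, he⟩
    obtain ⟨a, b, hab⟩ := H.exists_isLink_of_mem_edgeSet he
    by_cases ha : a ∈ X
    · exact ⟨a, b, hab, ha, (hX hab).1 ha⟩
    · exact ⟨b, a, hab.symm, by_contra fun hb => ha ((hX hab).2 hb), ha⟩
  choose r c hrc hr hc using hlink
  refine ⟨α, fun x => r (φ x), fun x => c (φ x), fun x y => ?_⟩
  dsimp only
  rw [← φ.map_adj_iff, SimpleGraph.compl_adj]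
  constructor
  · rintro ⟨hne, hnadj⟩
    exact ⟨fun h => hnadj ⟨hne, r (φ x), (hrc _).inc_left, by rw [h]; exact (hrc (φ y)).inc_left⟩,
      fun h => hnadj ⟨hne, c (φ x), (hrc _).inc_right, by rw [h]; exact (hrc (φ y)).inc_right⟩⟩
  · rintro ⟨h1, h2⟩
    refine ⟨fun h => h1 (by rw [h]), ?_⟩
    rintro ⟨-, a, hx, hy⟩
    -- A common end must be a row of both or a column of both, since rows lie in `X` and columns do
    -- not.
    obtain rfl | rfl := hx.eq_or_eq_of_isLink (hrc (φ x)) <;>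
      obtain h | h := hy.eq_or_eq_of_isLink (hrc (φ y))
    · exact h1 h
    · exact hc (φ y) (h ▸ hr (φ x))
    · exact hc (φ x) (h ▸ hr (φ y))
    · exact h2 h

/-- In a pathwise tough graph, points of `T` in different components of the graph induced on `T`
are bounded in number. -/
theorem SimpleGraph.IsPathwiseTough.card_le {V : Type u} [Fintype V] {G : SimpleGraph V}
    (hG : G.IsPathwiseTough) {ι : Type*} (T : Finset V) (f : ι → V) (hf : ∀ i, f i ∈ T)
    (hinj : ∀ i j, (G.induce (T : Set V)).Reachable ⟨f i, hf i⟩ ⟨f j, hf j⟩ → i = j) :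
    Nat.card ι + T.card ≤ Fintype.card V + 1 := by
  classical
  have h := hG Tᶜ
  rw [Finset.coe_compl, compl_compl] at h
  have h1 : Nat.card ι ≤ Nat.card (G.induce (T : Set V)).ConnectedComponent :=
    Nat.card_le_card_of_injective
      (fun i => (G.induce (T : Set V)).connectedComponentMk ⟨f i, hf i⟩)
      fun i j hij => hinj i j (SimpleGraph.ConnectedComponent.exact hij)
  have h2 := T.card_add_card_compl
  omega

theorem SimpleGraph.Reachable.of_induce {V : Type*} {G : SimpleGraph V} {s : Set V} {p : V → Prop}
    (hp : ∀ x ∈ s, ∀ y ∈ s, G.Adj x y → p x → p y) {x y : s} (h : (G.induce s).Reachable x y)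
    (hx : p x) : p y := by
  obtain ⟨q⟩ := h
  induction q with
  | nil => exact hx
  | @cons a b _ hadj _ ih => exact ih (hp a a.2 b b.2 hadj hx)

theorem SimpleGraph.IsPathwiseTough.two_mul_card_line_le {V : Type u} [Fintype V]
    {α : Type*} [DecidableEq α] {G : SimpleGraph V} (hG : G.IsPathwiseTough) {f : V → α}
    (hf : ∀ x y, G.Adj x y → f x ≠ f y) (e : V) :
    2 * (lineThrough f Finset.univ e).card ≤ Fintype.card V + 1 := by
  have h := hG.card_le (lineThrough f Finset.univ e)
    (fun x : lineThrough f Finset.univ e => (x : V)) (fun x => x.2) fun i j hij => by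
      refine Subtype.ext (hij.of_induce (p := fun x => x = (i : V)) ?_ rfl).symm
      intro x hx y hy hxy _
      exact absurd ((mem_lineThrough.1 hx).2.trans (mem_lineThrough.1 hy).2.symm) (hf _ _ hxy)
  rw [Nat.card_eq_fintype_card, Fintype.card_coe] at h
  omega

/-- A line is independent. In the union of the two lines `R`, `C` through a corner, each point of `R
∩ C` is isolated and `x` adds another component, so the bound is on `|R ∩ C| + 1 + |R ∪ C| = |R| +
|C| + 1`. A full square is disconnected. -/
theorem SimpleGraph.IsPathwiseTough.isBalanced {V : Type u} [Fintype V] {α β : Type*}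
    [DecidableEq α] [DecidableEq β] {G : SimpleGraph V} {r : V → α} {c : V → β}
    (hadj : ∀ x y, G.Adj x y ↔ r x ≠ r y ∧ c x ≠ c y) (hG : G.IsPathwiseTough) :
    IsBalanced r c (Finset.univ : Finset V) where
  row e _ := hG.two_mul_card_line_le (fun x y h => ((hadj x y).1 h).1) e
  col e _ := hG.two_mul_card_line_le (fun x y h => ((hadj x y).1 h).2) e
  corner e _ hc := by
    classical
    obtain ⟨⟨x, -, hxr, hxc⟩, -⟩ := hc
    set R := lineThrough r Finset.univ e
    set C := lineThrough c Finset.univ e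
    have hlonely : ∀ z ∈ R ∩ C, ∀ y ∈ R ∪ C, ¬ G.Adj z y := by
      intro z hz y hy h
      rw [hadj] at h
      simp only [R, C, Finset.mem_inter, Finset.mem_union, mem_lineThrough] at hz hy
      obtain hy | hy := hy
      · exact h.1 (hz.1.2.trans hy.2.symm)
      · exact h.2 (hz.2.2.trans hy.2.symm)
    have hreach : ∀ (z y : V) (hz : z ∈ R ∪ C) (hy : y ∈ R ∪ C), z ∈ R ∩ C →
        (G.induce ((R ∪ C : Finset V) : Set V)).Reachable ⟨z, hz⟩ ⟨y, hy⟩ → y = z :=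
      fun z y hz hy hzRC h => h.of_induce (p := fun x => x = z)
        (fun a _ b hb hab ha => absurd hab (by
          subst ha
          exact hlonely _ hzRC _ hb)) rfl
    have hx : x ∈ R ∪ C := Finset.mem_union_left _ (mem_lineThrough.2 ⟨Finset.mem_univ _, hxr⟩)
    have hxRC : x ∉ R ∩ C := fun h =>
      hxc (mem_lineThrough.1 (Finset.mem_inter.1 h).2).2
    have hsub : ∀ z ∈ R ∩ C, z ∈ R ∪ C := fun z hz =>
      Finset.mem_union_left _ (Finset.mem_inter.1 hz).1
    have h := hG.card_le (R ∪ C) (fun i : Option (R ∩ C : Finset V) => i.elim x Subtype.val)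
      (fun i => by
        cases i with
        | none => exact hx
        | some z => exact hsub z z.2) fun i j hij => by
      cases i with
      | none =>
        cases j with
        | none => rfl
        | some z => exact absurd (hreach z x _ _ z.2 hij.symm) (by rintro h; exact hxRC (h ▸ z.2))
      | some y =>
        cases j with
        | none => exact absurd (hreach y x _ _ y.2 hij) (by rintro h; exact hxRC (h ▸ y.2))
        | some z => exact congrArg some (Subtype.ext (hreach y z _ _ y.2 hij).symm)
    rw [Nat.card_eq_fintype_card, Fintype.card_option, Fintype.card_coe] at h
    have := Finset.card_union_add_card_inter R C
    rw [Finset.card_univ]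
    omega
  not_square := by
    rintro ⟨a, -, b, -, ⟨x, -, hx1, hx2⟩, -, h1, h2, h3⟩
    have h := hG.card_le Finset.univ (fun i : Bool => if i then a else x) (by simp) fun i j hij => by
      have key : ∀ i j : Bool, (G.induce ((Finset.univ : Finset V) : Set V)).Reachable
          ⟨if i then a else x, by simp⟩ ⟨if j then a else x, by simp⟩ → i = true → j = true := by
        intro i j hij hi
        -- Each edge of a full square switches both row and column, so the diagonal a point lies on
        -- is constant on components.
        have := hij.of_induce (p := fun z => r z = r a ↔ c z = c a) (fun y _ z _ hyz hy => by
          have hyz' := (hadj _ _).1 hyz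
          have hy' := h3 y (Finset.mem_univ _)
          have hz' := h3 z (Finset.mem_univ _)
          grind) (by simp [hi])
        by_contra hj
        simp only [hj] at this
        grind
      have h1 := key i j hij
      have h2 := key j i hij.symm
      cases i <;> cases j <;> simp_all
    simp only [Nat.card_eq_fintype_card, Fintype.card_bool, Finset.card_univ] at h
    omega

theorem SimpleGraph.hasHamiltonianPath_of_isChain {V : Type u} [DecidableEq V] [Fintype V]
    [Nonempty V] {G : SimpleGraph V} {l : List V} (hl : l.Perm Finset.univ.toList)
    (hc : l.IsChain G.Adj) : G.HasHamiltonianPath := by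
  have hne : l ≠ [] := by
    rintro rfl
    have := hl.length_eq
    rw [List.length_nil, Finset.length_toList, Finset.card_univ] at this
    exact absurd this.symm Fintype.card_ne_zero
  refine ⟨_, _, SimpleGraph.Walk.ofSupport l hne hc, fun a => ?_⟩
  rw [SimpleGraph.Walk.support_ofSupport, hl.count_eq]
  exact List.count_eq_one_of_mem (Finset.nodup_toList _) (by simp)

/-- Send each component to the predecessor of its first vertex on the path. This lies in `S`, or is
missing (`none`) for the start of the path, and it determines the component. -/
theorem SimpleGraph.HasHamiltonianPath.isPathwiseTough {V : Type u} [Fintype V] [DecidableEq V]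
    {G : SimpleGraph V} (h : G.HasHamiltonianPath) : G.IsPathwiseTough := by
  classical
  obtain ⟨a, b, p, hp⟩ := h
  intro S
  set G' := G.induce ((S : Set V)ᶜ)
  have hfirst : ∀ K : G'.ConnectedComponent, ∃ n : ℕ, n ≤ p.length ∧
      (∃ hn : p.getVert n ∈ (S : Set V)ᶜ, G'.connectedComponentMk ⟨_, hn⟩ = K) ∧
      ∀ m, n = m + 1 → p.getVert m ∈ S := by
    intro K
    have hex : ∃ n : ℕ, n ≤ p.length ∧
        ∃ hn : p.getVert n ∈ (S : Set V)ᶜ, G'.connectedComponentMk ⟨_, hn⟩ = K := by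
      induction K using SimpleGraph.ConnectedComponent.ind with
      | h x =>
        obtain ⟨n, hn, hnp⟩ := SimpleGraph.Walk.mem_support_iff_exists_getVert.1
          (hp.mem_support (x : V))
        exact ⟨n, hnp, by rw [hn]; exact x.2, by congr⟩
    refine ⟨Nat.find hex, (Nat.find_spec hex).1, (Nat.find_spec hex).2, fun m hm => ?_⟩
    by_contra hmS
    obtain ⟨hle, hn, hK⟩ := Nat.find_spec hex
    refine Nat.find_min hex (m := m) (by omega) ⟨by omega, by simpa using hmS, ?_⟩
    rw [← hK, SimpleGraph.ConnectedComponent.eq]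
    refine SimpleGraph.Adj.reachable ?_
    have hadj : G.Adj (p.getVert m) (p.getVert (m + 1)) := p.adj_getVert_succ (by omega)
    rw [← hm] at hadj
    exact hadj
  choose n hn hK hS using hfirst
  choose hnS hK using hK
  have hinj : Function.Injective fun K => (if hK : n K = 0 then none else
      some ⟨p.getVert (n K - 1), hS K _ (by omega)⟩ : Option S) := by
    intro K K' heq
    have hnn : n K = n K' := by
      have := hn K
      have := hn K'
      by_cases h0 : n K = 0 <;> by_cases h0' : n K' = 0 <;> simp [h0, h0'] at heq
      · omega
      · have := hp.isPath.getVert_injOn (by simp; omega) (by simp; omega) heq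
        omega
    rw [← hK K, ← hK K']
    congr
  have := Nat.card_le_card_of_injective _ hinj
  simpa using this

end Toughness

theorem mainTheorem2 {V : Type u} [Fintype V] [DecidableEq V] [Nonempty V]
    (G : SimpleGraph V) (hG : SimpleGraph.IsSkew.{u, v, w} G) :
    G.HasHamiltonianPath ↔ G.IsPathwiseTough := by
  classical
  refine ⟨fun h => h.isPathwiseTough, fun h => ?_⟩
  obtain ⟨α, r, c, hadj⟩ := hG.exists_coordinates
  obtain ⟨l, hl, hc⟩ := (h.isBalanced hadj).exists_isChain
  exact SimpleGraph.hasHamiltonianPath_of_isChain hl (hc.imp fun x y => (hadj x y).2)
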